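/- **Setting.** All theories are first-order theories in the language $\mathcal L=\{\in\}$; $T\vdash\sigma$ means that $\sigma$ is a first-order consequence of $T$. In all schemes the formula $\phi$ may contain parameters (free variables other than those displayed), which are universally quantified. $\mathrm{EST}$ (Elementary Set Theory) consists of Extensionality, Empty Set, Pairing, Union, Cartesian Product (for all $M,N$ the set $M\times N=\{\langle x,y\rangle : x\in M,\ y\in N\}$ exists, with $\langle x,y\rangle=\{\{x\},\{x,y\}\}$), $\Delta_0$-Separation, and the scheme $Ind(\omega)$ of induction along the class $\omega=\{x: Nat(x)\}$: for every formula $\phi(x)$ with $\forall x(\phi(x)\to Nat(x))$, $$[\phi(\emptyset)\wedge(\forall x\in\omega)(\phi(x)\to\phi(x\cup\{x\}))]\to(\forall x\in\omega)\,\phi(x).$$ Here $Nat(x)$ says that $x$ is transitive, that $y\in z\vee y=z\vee z\in y$ for all $y,z\in x$, and that every $y\in x\cup\{x\}$ is either $\emptyset$ or of the form $z\cup\{z\}$ with $z\in y$. For a set $A$, let $L_A$ be a first-order language with equality, with at most one unary relation symbol $\mathbf U$, at most one binary relation symbol $\mathbf R$, and a constant $\mathbf c_a$ for each $a\in A$.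 An $L_A$-structure is a tuple $\langle M,U,R,I\rangle$ with $U\subseteq M$, $R\subseteq M\times M$ and $I:A\to M$ a function that interprets the constants; $U$ or $R$ is omitted from the tuple if $\mathbf U$ or $\mathbf R$ is missing from $L_A$. The formulas of $L_A$ and their satisfaction in $L_A$-structures are coded by sets and defined within $\mathrm{EST}$ as usual, where an assignment $h$ of elements of $M$ to the variables $v_0,\dots,v_{n-1}$, $n\in\omega$, is coded as the ordered $n$-tuple $\langle\langle 0,h(0)\rangle,\dots,\langle n-1,h(n-1)\rangle\rangle$. An $L_A$-elementary embedding $f:\mathcal M\precsim_{L_A}\mathcal N$ is a one-to-one function between the domains that preserves satisfaction of every $L_A$-formula in both directions. $\mathrm{VP}$ (Vopěnka's Principle) is the scheme consisting, for every formula $\phi(x)$ of $\mathcal L$, of the following, where $X_\phi=\{x:\phi(x)\}$: for every set $A$ (and every choice of which of $\mathbf U,\mathbf R$ belong to $L_A$), if $X_\phi$ is a proper class of $L_A$-structures, that is, every element of $X_\phi$ is an $L_A$-structure and no set has exactly the elements of $X_\phi$, then there are $\mathcal M\neq\mathcal N$ in $X_\phi$ and $f$ such that $f:\mathcal M\precsim_{L_A}\mathcal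 N$. $\Delta_0\text{-}\mathrm{Rep}$ is the scheme: for every $\Delta_0$ formula $\phi(x,y)$, if $\forall x\,\exists! y\,\phi(x,y)$, then for every set $A$ the class $\{y:(\exists x\in A)\,\phi(x,y)\}$ is a set. $Pow$ is the axiom: for every $a$ there is a set whose elements are exactly the subsets of $a$. **Theorem.** $\mathrm{EST}+\mathrm{VP}+\Delta_0\text{-}\mathrm{Rep}\vdash Pow$, and moreover $\mathrm{EST}+\mathrm{VP}\vdash Pow$. -/

import Mathlib

/-! # Elementary set theory with Vopenka's Principle, as first-order theories in the language `{∈}`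

All theories below are sets of sentences of one first-order language with a single binary relation
symbol. Derivability from a theory is Mathlib's first-order consequence relation `⊨ᵇ`. -/

namespace VopenkaEST

open FirstOrder FirstOrder.Language

/-- The only nonlogical symbol of the language of set theory: the binary symbol `∈`. -/
inductive SetRel : ℕ → Type
  | mem : SetRel 2

/-- The language `{∈}` of set theory. -/
abbrev LSet : Language := ⟨fun _ => Empty, SetRel⟩

/-! ## Writing formulas with named variables

The variables are `x₀, x₁, x₂, …`, and a variable is referred to by its index. A value of `Fm` is a
formula that still has to be told the first index `n` such that no variable `xᵢ` with `n ≤ i` is in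
use; a quantifier binds the variable `xₙ`, so that variables are never captured. -/

/-- Formulas of set theory, waiting for the first unused variable index. -/
abbrev Fm : Type := ℕ → LSet.Formula ℕ

/-- The formula `∀ xₖ, φ`. -/
def bindAll (k : ℕ) (φ : LSet.Formula ℕ) : LSet.Formula ℕ :=
  (BoundedFormula.relabel (n := 1)
    (fun i : ℕ => if i = k then (Sum.inr 0 : ℕ ⊕ Fin 1) else Sum.inl i) φ).all

/-- `xᵢ ∈ xⱼ`. -/
def mem (i j : ℕ) : Fm := fun _ => Relations.formula₂ (L := LSet) SetRel.mem (Term.var i) (Term.var j)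
/-- `xᵢ = xⱼ`. -/
def eq (i j : ℕ) : Fm := fun _ => Term.equal (Term.var i) (Term.var j)
/-- Falsity. -/
def falsity : Fm := fun _ => ⊥
/-- Implication. -/
def imp (F G : Fm) : Fm := fun n => (F n).imp (G n)
/-- Negation. -/
def neg (F : Fm) : Fm := fun n => (F n).not
/-- Conjunction. -/
def conj (F G : Fm) : Fm := fun n => F n ⊓ G n
/-- Disjunction. -/
def disj (F G : Fm) : Fm := fun n => F n ⊔ G n
/-- Equivalence. -/
def equiv (F G : Fm) : Fm := fun n => (F n).iff (G n)
/-- Universal quantification. -/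
def all (F : ℕ → Fm) : Fm := fun n => bindAll n (F n (n + 1))
/-- Existential quantification. -/
def ex (F : ℕ → Fm) : Fm := neg (all fun x => neg (F x))

infix:70 " ε " => mem
infix:70 " ≐ " => eq
infixr:50 " ⋏ " => conj
infixr:45 " ⋎ " => disj
infixr:40 " ⇒ " => imp
infix:35 " ⇌ " => equiv

/-- `∀ y ∈ a, F y`. -/
def allIn (a : ℕ) (F : ℕ → Fm) : Fm := all fun y => y ε a ⇒ F y
/-- `∃ y ∈ a, F y`. -/
def exIn (a : ℕ) (F : ℕ → Fm) : Fm := ex fun y => y ε a ⋏ F y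
/-- `F` if the flag `b` is set, and falsity otherwise. -/
def onlyIf (b : Bool) (F : Fm) : Fm := if b then F else falsity

/-- The universal closure of a formula whose free variables are among `x₀, …, xₖ₋₁`
(with one more, idle, quantifier for `xₖ`). -/
def close (k : ℕ) (F : Fm) : LSet.Sentence :=
  (BoundedFormula.relabel (n := k + 1)
    (fun i : ℕ => (Sum.inr (Fin.ofNat (k + 1) i) : Empty ⊕ Fin (k + 1))) (F k)).alls

/-- A formula `φ(p₀, …, pₖ₋₁, y₀, …, yᵣ₋₁)` with parameters `p` and arguments `y`, where the
parameters are read as the variables `x₀, …, xₖ₋₁` and the arguments as the variables `a 0, …`. -/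
def inst {k r : ℕ} (φ : LSet.Formula (Fin k ⊕ Fin r)) (a : Fin r → ℕ) : Fm :=
  fun _ => φ.relabel (Sum.elim (fun i : Fin k => (i : ℕ)) a)

/-- `Δ₀` formulas: built from atomic formulas by propositional connectives and the bounded
quantifiers `∀ x ∈ t` and `∃ x ∈ t` (`t` is a term, that is a variable, other than `x`). -/
inductive IsDelta0 {α : Type} : ∀ {n : ℕ}, LSet.BoundedFormula α n → Prop
  | falsum {n} : IsDelta0 (BoundedFormula.falsum : LSet.BoundedFormula α n)
  | equal {n} (s t : LSet.Term (α ⊕ Fin n)) : IsDelta0 (BoundedFormula.equal s t)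
  | rel {n m} (R : LSet.Relations m) (ts : Fin m → LSet.Term (α ⊕ Fin n)) :
      IsDelta0 (BoundedFormula.rel R ts)
  | imp {n} {φ ψ : LSet.BoundedFormula α n} : IsDelta0 φ → IsDelta0 ψ → IsDelta0 (φ.imp ψ)
  | ballMem {n} (t : LSet.Term (α ⊕ Fin n)) {φ : LSet.BoundedFormula α (n + 1)} : IsDelta0 φ →
      IsDelta0 (BoundedFormula.all ((Relations.boundedFormula₂ (L := LSet) SetRel.mem
        (Term.var (Sum.inr (Fin.last n))) (t.relabel (Sum.map id Fin.castSucc))).imp φ))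
  | bexMem {n} (t : LSet.Term (α ⊕ Fin n)) {φ : LSet.BoundedFormula α (n + 1)} : IsDelta0 φ →
      IsDelta0 (BoundedFormula.ex (Relations.boundedFormula₂ (L := LSet) SetRel.mem
        (Term.var (Sum.inr (Fin.last n))) (t.relabel (Sum.map id Fin.castSucc)) ⊓ φ))

/-! ## Elementary notions of set theory -/

/-- `x ⊆ y`. -/
def subset (x y : ℕ) : Fm := allIn x fun z => z ε y
/-- `x = ∅`. -/
def isEmpty (x : ℕ) : Fm := all fun z => neg (z ε x)
/-- `p = {x, y}`. -/
def isUPair (x y p : ℕ) : Fm := all fun z => z ε p ⇌ z ≐ x ⋎ z ≐ y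
/-- `p = ⟨x, y⟩ = {{x}, {x, y}}`. -/
def isPair (x y p : ℕ) : Fm :=
  ex fun s => ex fun t => isUPair x x s ⋏ isUPair x y t ⋏ isUPair s t p
/-- `p = ⟨x, y, z⟩ = ⟨⟨x, y⟩, z⟩`. -/
def isTriple (x y z p : ℕ) : Fm := ex fun q => isPair x y q ⋏ isPair q z p
/-- `p = ⟨x, y, z, w⟩ = ⟨⟨x, y, z⟩, w⟩`. -/
def isQuadruple (x y z w p : ℕ) : Fm := ex fun q => isTriple x y z q ⋏ isPair q w p
/-- `y = x ∪ {x}`. -/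
def isSucc (x y : ℕ) : Fm := all fun z => z ε y ⇌ z ε x ⋎ z ≐ x
/-- `x` is a transitive set. -/
def isTrans (x : ℕ) : Fm := allIn x fun y => subset y x
/-- `Ord(x)`: `x` is transitive and linearly ordered by `∈`. -/
def isOrd (x : ℕ) : Fm :=
  isTrans x ⋏ allIn x fun y => allIn x fun z => y ε z ⋎ y ≐ z ⋎ z ε y
/-- `Succ(x)`: `x = y ∪ {y}` for some `y ∈ x`. -/
def isSuccessor (x : ℕ) : Fm := exIn x fun y => isSucc y x
/-- `Nat(x)`, that is, `x ∈ ω` (`ω` is a class). -/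
def isNat (x : ℕ) : Fm :=
  isOrd x ⋏ all fun y => (y ε x ⋎ y ≐ x) ⇒ (isEmpty y ⋎ isSuccessor y)
/-- `x` is the numeral `k`, where `0 = ∅` and `k + 1 = k ∪ {k}`. -/
def isNumeral : ℕ → ℕ → Fm
  | 0, x => isEmpty x
  | k + 1, x => ex fun y => isNumeral k y ⋏ isSucc y x

/-- `⟨x, y⟩ ∈ f`. -/
def app (f x y : ℕ) : Fm := exIn f fun p => isPair x y p
/-- `f` is a (set) function from `M` to `N`. -/
def isFun (f M N : ℕ) : Fm :=
  (allIn f fun p => exIn M fun x => exIn N fun y => isPair x y p) ⋏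
  (allIn M fun x => exIn N fun y => app f x y) ⋏
  (all fun x => all fun y => all fun z => app f x y ⋏ app f x z ⇒ y ≐ z)
/-- `f` is a (set) function with domain `n`. -/
def isFunOn (f n : ℕ) : Fm :=
  (allIn f fun p => exIn n fun x => ex fun y => isPair x y p) ⋏
  (allIn n fun x => ex fun y => app f x y) ⋏
  (all fun x => all fun y => all fun z => app f x y ⋏ app f x z ⇒ y ≐ z)
/-- `f` is one-to-one (for a function `f`). -/
def isInj (f : ℕ) : Fm :=
  all fun x => all fun y => all fun z => app f x z ⋏ app f y z ⇒ x ≐ y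

/-! ## The axioms of EST, `Δ₀`-Replacement and Powerset -/

/-- Extensionality. -/
def axExt : LSet.Sentence :=
  close 0 <| all fun x => all fun y => (all fun z => z ε x ⇌ z ε y) ⇒ x ≐ y
/-- Empty Set. -/
def axEmpty : LSet.Sentence := close 0 <| ex fun x => isEmpty x
/-- Pairing. -/
def axPair : LSet.Sentence := close 0 <| all fun x => all fun y => ex fun p => isUPair x y p
/-- Union. -/
def axUnion : LSet.Sentence :=
  close 0 <| all fun x => ex fun u => all fun z => z ε u ⇌ exIn x fun y => z ε y
/-- Cartesian Product. -/
def axCartProd : LSet.Sentence :=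
  close 0 <| all fun M => all fun N => ex fun P => all fun p =>
    p ε P ⇌ exIn M fun x => exIn N fun y => isPair x y p
/-- The instance of Separation for `φ(x)` (with parameters). -/
def axSep {k : ℕ} (φ : LSet.Formula (Fin k ⊕ Fin 1)) : LSet.Sentence :=
  close k <| all fun a => ex fun b => all fun x => x ε b ⇌ x ε a ⋏ inst φ ![x]
/-- The instance of Induction along `ω` for `φ(x)` (with parameters): if `φ` defines a subclass of
`ω` which contains `∅` and is closed under `x ↦ x ∪ {x}`, then it contains every element of `ω`. -/
def axInd {k : ℕ} (φ : LSet.Formula (Fin k ⊕ Fin 1)) : LSet.Sentence :=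
  close k <| (all fun x => inst φ ![x] ⇒ isNat x) ⇒
    ((all fun x => isEmpty x ⇒ inst φ ![x]) ⋏
      (all fun x => isNat x ⇒ inst φ ![x] ⇒ all fun y => isSucc x y ⇒ inst φ ![y])) ⇒
    all fun x => isNat x ⇒ inst φ ![x]
/-- The instance of Replacement for `φ(x, y)` (with parameters): if `φ` defines a class function,
then the image of every set is a set. -/
def axRep {k : ℕ} (φ : LSet.Formula (Fin k ⊕ Fin 2)) : LSet.Sentence :=
  close k <| (all fun x => ex fun y => all fun z => inst φ ![x, z] ⇌ z ≐ y) ⇒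
    all fun a => ex fun b => all fun y => y ε b ⇌ exIn a fun x => inst φ ![x, y]
/-- Powerset. -/
def axPow : LSet.Sentence :=
  close 0 <| all fun a => ex fun b => all fun x => x ε b ⇌ subset x a

/-- The theory `EST₀`. -/
def EST₀ : LSet.Theory :=
  {axExt, axEmpty, axPair, axUnion, axCartProd} ∪
  {σ | ∃ (k : ℕ) (φ : LSet.Formula (Fin k ⊕ Fin 1)), IsDelta0 φ ∧ σ = axSep φ}

/-- Elementary Set Theory: `EST₀` with the scheme of induction along `ω`, for all formulas. -/
def EST : LSet.Theory :=
  EST₀ ∪ {σ | ∃ (k : ℕ) (φ : LSet.Formula (Fin k ⊕ Fin 1)), σ = axInd φ}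

/-- The scheme of `Δ₀`-Replacement. -/
def Delta0Rep : LSet.Theory :=
  {σ | ∃ (k : ℕ) (φ : LSet.Formula (Fin k ⊕ Fin 2)), IsDelta0 φ ∧ σ = axRep φ}

/-! ## The languages `L_A`, coded inside set theory

The flags `u` and `r` say whether the unary symbol `U` and the binary symbol `R` belong to the
language. Besides these, `L_A` has a constant `c_a` for each `a ∈ A`. The codes are
`vᵢ = ⟨0, i⟩`, `c_a = ⟨1, a⟩`, `≡ = 2`, `¬ = 3`, `∧ = 4`, `∃ = 5`, `U = 6`, `R = 7`. -/

/-- `t` is the variable `vᵢ`. -/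
def isVar (i t : ℕ) : Fm := ex fun o => isNumeral 0 o ⋏ isPair o i t
/-- `t` is the constant `c_a`. -/
def isConst (a t : ℕ) : Fm := ex fun o => isNumeral 1 o ⋏ isPair o a t
/-- `x = ⟨c, t⟩`, where `c` is a numeral. -/
def isCode₁ (c : ℕ) (t x : ℕ) : Fm := ex fun o => isNumeral c o ⋏ isPair o t x
/-- `x = ⟨c, s, t⟩`, where `c` is a numeral. -/
def isCode₂ (c : ℕ) (s t x : ℕ) : Fm := ex fun o => isNumeral c o ⋏ isTriple o s t x

/-- `t` is a term of `L_A`: a constant, or a variable `vᵢ` with `i < m`. -/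
def isTerm (A m t : ℕ) : Fm := (exIn m fun i => isVar i t) ⋎ (exIn A fun a => isConst a t)
/-- `x` is an atomic formula of `L_A` with variables among the `vᵢ`, `i < m`. -/
def isAtomic (u r : Bool) (A m x : ℕ) : Fm :=
  (ex fun s => ex fun t => isTerm A m s ⋏ isTerm A m t ⋏ isCode₂ 2 s t x) ⋎
  onlyIf u (ex fun t => isTerm A m t ⋏ isCode₁ 6 t x) ⋎
  onlyIf r (ex fun s => ex fun t => isTerm A m s ⋏ isTerm A m t ⋏ isCode₂ 7 s t x)
/-- `f` is a function with domain the nonzero natural number `n`, it has last value `x`, and each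
of its values is an atomic formula of `L_A`, or the negation, the conjunction or an existential
quantification of earlier values; all variables, free or bound, are among the `vᵢ`, `i < m`. -/
def isFormation (u r : Bool) (A m x f n : ℕ) : Fm :=
  isNat n ⋏ isFunOn f n ⋏ (exIn n fun k => isSucc k n ⋏ app f k x) ⋏
  allIn n fun k => ex fun y => app f k y ⋏
    (isAtomic u r A m y ⋎
     (exIn k fun j => ex fun z => app f j z ⋏ isCode₁ 3 z y) ⋎
     (exIn k fun j => exIn k fun l => ex fun z => ex fun w =>
        app f j z ⋏ app f l w ⋏ isCode₂ 4 z w y) ⋎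
     (exIn k fun j => exIn m fun i => ex fun z => app f j z ⋏ isCode₂ 5 i z y))
/-- `x` is a formula of `L_A` whose variables, free or bound, are among the `vᵢ`, `i < m`. (Every
formula is of this form for some `m ∈ ω`.) -/
def isFormula (u r : Bool) (A m x : ℕ) : Fm :=
  ex fun f => ex fun n => isFormation u r A m x f n

/-! ## Structures, satisfaction, elementary embeddings -/

/-- `S` codes the structure with domain `M`, relations `U`, `R` and constant assignment `I`:
it is `⟨M, U, R, I⟩`, or the shorter tuple without `U` or `R` when that symbol is missing from the
language (in this case the missing relation is read as `∅`). -/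
def isCoded : (u r : Bool) → (M U R I S : ℕ) → Fm
  | true, true, M, U, R, I, S => isQuadruple M U R I S
  | true, false, M, U, R, I, S => isEmpty R ⋏ isTriple M U I S
  | false, true, M, U, R, I, S => isEmpty U ⋏ isTriple M R I S
  | false, false, M, U, R, I, S => isEmpty U ⋏ isEmpty R ⋏ isPair M I S

/-- `S` is the `L_A`-structure `⟨M, U, R, I⟩`: `U ⊆ M`, `R ⊆ M × M` and `I : A → M`. -/
def isStructureWith (u r : Bool) (A M U R I S : ℕ) : Fm :=
  isCoded u r M U R I S ⋏ subset U M ⋏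
  (allIn R fun p => exIn M fun x => exIn M fun y => isPair x y p) ⋏ isFun I A M
/-- `S` is an `L_A`-structure. -/
def isStructure (u r : Bool) (A S : ℕ) : Fm :=
  ex fun M => ex fun U => ex fun R => ex fun I => isStructureWith u r A M U R I S

/-- For a sequence `s` of partial tuples `s(0) = ⟨0, x₀⟩`, `s(i + 1) = ⟨s(i), ⟨i + 1, xᵢ₊₁⟩⟩`: the
entry `xᵢ` is `x`. -/
def seqEntry (s i x : ℕ) : Fm :=
  ex fun p => isPair i x p ⋏
    ((isEmpty i ⋏ app s i p) ⋎
     (exIn i fun j => isSucc j i ⋏ ex fun q => ex fun t => app s j q ⋏ isPair q p t ⋏ app s i t))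
/-- For nonzero `n`: `h` is an `n`-tuple `⟨⟨0, x₀⟩, …, ⟨n - 1, xₙ₋₁⟩⟩` (associated to the left) and
`s` is the sequence of its initial segments. -/
def isTupleVia (n h s : ℕ) : Fm :=
  isFunOn s n ⋏ (exIn n fun k => isSucc k n ⋏ app s k h) ⋏ allIn n fun i => ex fun x => seqEntry s i x
/-- `h(i) = x`, for an `n`-tuple `h = ⟨⟨0, x₀⟩, …, ⟨n - 1, xₙ₋₁⟩⟩` and `i < n`. -/
def entry (n h i x : ℕ) : Fm := ex fun s => isTupleVia n h s ⋏ i ε n ⋏ seqEntry s i x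
/-- `h ∈ ⁿM = ({0} × M) × ⋯ × ({n - 1} × M)`, with `⁰M = {∅}`. -/
def isAssign (n M h : ℕ) : Fm :=
  (isEmpty n ⋏ isEmpty h) ⋎
  ex fun s => isTupleVia n h s ⋏ allIn n fun i => exIn M fun x => seqEntry s i x

/-- `y` is the value of the term `t` under the assignment `h ∈ ᵐM`. -/
def isValue (A I m h t y : ℕ) : Fm :=
  (exIn m fun i => isVar i t ⋏ entry m h i y) ⋎ (exIn A fun a => isConst a t ⋏ app I a y)
/-- `G = {h ∈ ᵐM : F h}`. -/
def isAssignSet (m M G : ℕ) (F : ℕ → Fm) : Fm := all fun h => h ε G ⇌ isAssign m M h ⋏ F h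
/-- Given that `f` enumerates the subformulas of a formula and that `g(j)`, for `j < k`, is the set
of assignments satisfying `f(j)`: `G` is the set of assignments satisfying the formula `x = f(k)`. -/
def satClause (u r : Bool) (A M U R I m f g k x G : ℕ) : Fm :=
  (ex fun s => ex fun t => isCode₂ 2 s t x ⋏ isAssignSet m M G fun h =>
      ex fun y => isValue A I m h s y ⋏ isValue A I m h t y) ⋎
  onlyIf u (ex fun t => isCode₁ 6 t x ⋏ isAssignSet m M G fun h =>
      exIn U fun y => isValue A I m h t y) ⋎
  onlyIf r (ex fun s => ex fun t => isCode₂ 7 s t x ⋏ isAssignSet m M G fun h =>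
      ex fun y => ex fun z => isValue A I m h s y ⋏ isValue A I m h t z ⋏ app R y z) ⋎
  (exIn k fun j => ex fun z => ex fun H => app f j z ⋏ app g j H ⋏ isCode₁ 3 z x ⋏
      isAssignSet m M G fun h => neg (h ε H)) ⋎
  (exIn k fun j => exIn k fun l => ex fun z => ex fun w => ex fun H => ex fun K =>
      app f j z ⋏ app f l w ⋏ app g j H ⋏ app g l K ⋏ isCode₂ 4 z w x ⋏
      isAssignSet m M G fun h => h ε H ⋏ h ε K) ⋎
  (exIn k fun j => exIn m fun i => ex fun z => ex fun H =>
      app f j z ⋏ app g j H ⋏ isCode₂ 5 i z x ⋏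
      isAssignSet m M G fun h => exIn H fun h' =>
        allIn m fun l => neg (l ≐ i) ⇒ all fun y => entry m h l y ⇌ entry m h' l y)
/-- Satisfaction: the assignment `e ∈ ᵐM` satisfies the formula `x` (with variables among the `vᵢ`,
`i < m`) in `⟨M, U, R, I⟩`. -/
def sat (u r : Bool) (A M U R I m x e : ℕ) : Fm :=
  ex fun f => ex fun g => ex fun n => isFormation u r A m x f n ⋏ isFunOn g n ⋏
    (allIn n fun k => ex fun y => ex fun G => app f k y ⋏ app g k G ⋏
      satClause u r A M U R I m f g k y G) ⋏
    exIn n fun k => isSucc k n ⋏ ex fun G => app g k G ⋏ e ε G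

/-- `f` is an `L_A`-elementary embedding of the structure `S` into the structure `T`: a one-to-one
function between the domains which preserves satisfaction of every formula, in both directions. (The
clause on `∅` is what elementarity says about the sentence `∃ v, v ≡ v`; it has to be said, since
there is no assignment for the variables of a formula in the empty domain.) -/
def isElemEmb (u r : Bool) (A S T f : ℕ) : Fm :=
  ex fun M => ex fun U => ex fun R => ex fun I =>
  ex fun N => ex fun V => ex fun Q => ex fun J =>
    isStructureWith u r A M U R I S ⋏ isStructureWith u r A N V Q J T ⋏
    isFun f M N ⋏ isInj f ⋏ (isEmpty M ⇒ isEmpty N) ⋏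
    all fun m => all fun x => all fun d => all fun e =>
      isNat m ⋏ isFormula u r A m x ⋏ isAssign m M d ⋏ isAssign m N e ⋏
        (allIn m fun i => all fun y => all fun z => entry m d i y ⋏ app f y z ⇒ entry m e i z) ⇒
      (sat u r A M U R I m x d ⇌ sat u r A N V Q J m x e)

/-! ## Vopenka's Principle -/

/-- The instance of Vopenka's Principle for the class `X_φ = {y : φ(y)}` (with parameters): for
every set `A`, if `X_φ` is a proper class of `L_A`-structures, then there are distinct
`S, T ∈ X_φ` and an `L_A`-elementary embedding of `S` into `T`. The flags `u` and `r` tell which of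
`U` and `R` belong to the language `L_A`. -/
def axVP (u r : Bool) {k : ℕ} (φ : LSet.Formula (Fin k ⊕ Fin 1)) : LSet.Sentence :=
  close k <| all fun A =>
    (all fun y => inst φ ![y] ⇒ isStructure u r A y) ⋏
    (all fun x => ex fun y => (inst φ ![y] ⋏ neg (y ε x)) ⋎ (neg (inst φ ![y]) ⋏ y ε x)) ⇒
    ex fun S => ex fun T => inst φ ![S] ⋏ inst φ ![T] ⋏ neg (S ≐ T) ⋏
      ex fun f => isElemEmb u r A S T f

/-- The scheme `VP`: all instances, for all formulas and all choices of the relation symbols. -/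
def VP : LSet.Theory :=
  {σ | ∃ (u r : Bool) (k : ℕ) (φ : LSet.Formula (Fin k ⊕ Fin 1)), σ = axVP u r φ}

end VopenkaEST

/-! Consequence is semantic, so it suffices to argue inside an arbitrary model of EST + VP. Fix a
set `A`, let `I` be the identity on `A`, and take the language with `U` and a constant for each
element of `A`. Each `X ⊆ A` gives a structure ⟨A, X, I⟩, and the class of all of these is definable
from the parameters `A` and `I`.

An elementary embedding preserves every sentence U(c_a). Since c_a denotes `a`, an embedding of ⟨A,
X, I⟩ into ⟨A, Y, I⟩ forces a ∈ X ↔ a ∈ Y for every `a` in `A`, hence X = Y (`ElemEmb.eq`). By VP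
the class is therefore not proper. If it is a set `x`, every X ⊆ A lies a fixed number of unions
below `x`, and Δ₀-Separation cuts the powerset out of that iterated union (`exists_powerset`).

The labour lies in evaluating the coded satisfaction relation on U(c_a) (`sat_const_iff`). A witness
for satisfaction may be a formation sequence of any length n in ω, and its last index has to be
unique. In the absence of Foundation this comes from induction along ω (`Suc.inj_of_natOrd`). The
identity function is obtained by a Δ₀-Separation from A × A (`exists_identity`). -/

namespace VopenkaEST

open FirstOrder FirstOrder.Language

/-! ## Realization of formulas with named variables -/

section Realize

variable {M : Type*} [LSet.Structure M]

/-- The membership relation of a structure. -/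
def E (a b : M) : Prop := Structure.RelMap (L := LSet) SetRel.mem ![a, b]

/-- The relabelling sends the variable `k` to the bound slot, so quantifying amounts to overwriting
the assignment at `k`. All later translations then reduce to computing with `Function.update`. -/
theorem realize_bindAll (k : ℕ) (φ : LSet.Formula ℕ) (v : ℕ → M) :
    (bindAll k φ).Realize v ↔ ∀ a, φ.Realize (Function.update v k a) := by
  unfold bindAll Formula.Realize
  rw [BoundedFormula.realize_all]
  refine forall_congr' fun a => ?_
  rw [BoundedFormula.realize_relabel]
  have h : (Sum.elim v (Fin.snoc (default : Fin 0 → M) a ∘ Fin.castAdd 0) ∘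
      fun i : ℕ => if i = k then (Sum.inr 0 : ℕ ⊕ Fin 1) else Sum.inl i) =
      Function.update v k a := by
    funext i
    by_cases hi : i = k
    · subst hi
      simp [Fin.snoc]
    · simp [hi]
  have h' : (Fin.snoc (default : Fin 0 → M) a ∘ Fin.natAdd 1 : Fin 0 → M) = default :=
    Subsingleton.elim _ _
  rw [h, h']

theorem realize_mem (i j n : ℕ) (v : ℕ → M) : ((i ε j) n).Realize v ↔ E (v i) (v j) := by
  simp [mem, E, Formula.realize_rel₂]

theorem realize_eq (i j n : ℕ) (v : ℕ → M) : ((i ≐ j) n).Realize v ↔ v i = v j := by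
  simp [eq]

theorem realize_falsity (n : ℕ) (v : ℕ → M) : (falsity n).Realize v ↔ False := Iff.rfl

theorem realize_imp (F G : Fm) (n : ℕ) (v : ℕ → M) :
    ((F ⇒ G) n).Realize v ↔ ((F n).Realize v → (G n).Realize v) := by
  simp [imp]

theorem realize_neg (F : Fm) (n : ℕ) (v : ℕ → M) :
    ((neg F) n).Realize v ↔ ¬ (F n).Realize v := by
  simp [neg]

theorem realize_conj (F G : Fm) (n : ℕ) (v : ℕ → M) :
    ((F ⋏ G) n).Realize v ↔ ((F n).Realize v ∧ (G n).Realize v) := by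
  simp [conj]

theorem realize_disj (F G : Fm) (n : ℕ) (v : ℕ → M) :
    ((F ⋎ G) n).Realize v ↔ ((F n).Realize v ∨ (G n).Realize v) := by
  simp [disj]

theorem realize_equiv (F G : Fm) (n : ℕ) (v : ℕ → M) :
    ((F ⇌ G) n).Realize v ↔ ((F n).Realize v ↔ (G n).Realize v) := by
  simp [equiv]

theorem realize_all (F : ℕ → Fm) (n : ℕ) (v : ℕ → M) :
    ((all F) n).Realize v ↔ ∀ a, (F n (n + 1)).Realize (Function.update v n a) :=
  realize_bindAll _ _ _

theorem realize_ex (F : ℕ → Fm) (n : ℕ) (v : ℕ → M) :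
    ((ex F) n).Realize v ↔ ∃ a, (F n (n + 1)).Realize (Function.update v n a) := by
  simp only [ex, realize_neg, realize_all, not_forall, not_not]

/-- The condition `a < n` is freshness: the quantifier overwrites the variable `n`, so the bounding
set named by `a` keeps its value. -/
theorem realize_allIn {a n : ℕ} (h : a < n) (F : ℕ → Fm) (v : ℕ → M) :
    ((allIn a F) n).Realize v ↔
      ∀ b, E b (v a) → (F n (n + 1)).Realize (Function.update v n b) := by
  simp only [allIn, realize_all, realize_imp, realize_mem, Function.update_self,
    Function.update_of_ne h.ne]

theorem realize_exIn {a n : ℕ} (h : a < n) (F : ℕ → Fm) (v : ℕ → M) :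
    ((exIn a F) n).Realize v ↔
      ∃ b, E b (v a) ∧ (F n (n + 1)).Realize (Function.update v n b) := by
  simp only [exIn, realize_ex, realize_conj, realize_mem, Function.update_self,
    Function.update_of_ne h.ne]

theorem realize_onlyIf (b : Bool) (F : Fm) (n : ℕ) (v : ℕ → M) :
    ((onlyIf b F) n).Realize v ↔ b = true ∧ (F n).Realize v := by
  cases b <;> simp [onlyIf, realize_falsity]

theorem realize_close (k : ℕ) (F : Fm) :
    M ⊨ close k F ↔
      ∀ xs : Fin (k + 1) → M, (F k).Realize fun i => xs (Fin.ofNat (k + 1) i) := by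
  unfold close Sentence.Realize
  rw [BoundedFormula.realize_alls]
  refine forall_congr' fun xs => ?_
  rw [BoundedFormula.realize_relabel]
  have h : (xs ∘ Fin.natAdd (k + 1) : Fin 0 → M) = default := Subsingleton.elim _ _
  unfold Formula.Realize
  rw [h]
  rfl

theorem realize_inst {k r : ℕ} (φ : LSet.Formula (Fin k ⊕ Fin r)) (a : Fin r → ℕ) (n : ℕ)
    (v : ℕ → M) :
    ((inst φ a) n).Realize v ↔ φ.Realize (Sum.elim (fun i : Fin k => v i) (v ∘ a)) := by
  unfold inst
  rw [Formula.realize_relabel]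
  have : (v ∘ Sum.elim (fun i : Fin k => (i : ℕ)) a) =
      Sum.elim (fun i : Fin k => v i) (v ∘ a) := by
    funext i; cases i <;> rfl
  rw [this]

/-! ## Elementary notions, read in a structure -/

def Sub (x y : M) : Prop := ∀ z, E z x → E z y
def Emp (x : M) : Prop := ∀ z, ¬ E z x
def UPair (x y p : M) : Prop := ∀ z, E z p ↔ z = x ∨ z = y
def Pair (x y p : M) : Prop := ∃ s t, UPair x x s ∧ UPair x y t ∧ UPair s t p
def Triple (x y z p : M) : Prop := ∃ q, Pair x y q ∧ Pair q z p
def Suc (x y : M) : Prop := ∀ z, E z y ↔ E z x ∨ z = x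
def NatOrd (x : M) : Prop :=
  ((∀ y, E y x → Sub y x) ∧ ∀ y, E y x → ∀ z, E z x → E y z ∨ y = z ∨ E z y) ∧
    ∀ y, E y x ∨ y = x → Emp y ∨ ∃ z, E z y ∧ Suc z y
def Numeral : ℕ → M → Prop
  | 0, x => Emp x
  | k + 1, x => ∃ y, Numeral k y ∧ Suc y x
def App (f x y : M) : Prop := ∃ p, E p f ∧ Pair x y p
def Fun (f A B : M) : Prop :=
  (∀ p, E p f → ∃ x, E x A ∧ ∃ y, E y B ∧ Pair x y p) ∧
  (∀ x, E x A → ∃ y, E y B ∧ App f x y) ∧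
  ∀ x y z, App f x y ∧ App f x z → y = z
def FunOn (f n : M) : Prop :=
  (∀ p, E p f → ∃ x, E x n ∧ ∃ y, Pair x y p) ∧
  (∀ x, E x n → ∃ y, App f x y) ∧
  ∀ x y z, App f x y ∧ App f x z → y = z

section
variable {n x y z p : ℕ} (v : ℕ → M)

/-- This and the translations that follow peel off one layer of definitions each. Every freshness
side condition is an inequality between indices, which `omega` discharges. -/
theorem realize_subset (hx : x < n) (hy : y < n) :
    (subset x y n).Realize v ↔ Sub (v x) (v y) := by
  simp (disch := omega) only [subset, Sub, realize_allIn, realize_mem, Function.update_self,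
    Function.update_of_ne]

theorem realize_isEmpty (hx : x < n) : (isEmpty x n).Realize v ↔ Emp (v x) := by
  simp (disch := omega) only [isEmpty, Emp, realize_all, realize_neg, realize_mem,
    Function.update_self, Function.update_of_ne]

theorem realize_isUPair (hx : x < n) (hy : y < n) (hp : p < n) :
    (isUPair x y p n).Realize v ↔ UPair (v x) (v y) (v p) := by
  simp (disch := omega) only [isUPair, UPair, realize_all, realize_equiv, realize_disj, realize_mem,
    realize_eq, Function.update_self, Function.update_of_ne]

theorem realize_isPair (hx : x < n) (hy : y < n) (hp : p < n) :
    (isPair x y p n).Realize v ↔ Pair (v x) (v y) (v p) := by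
  simp (disch := omega) only [isPair, Pair, realize_ex, realize_conj, realize_isUPair,
    Function.update_self, Function.update_of_ne]

theorem realize_isTriple (hx : x < n) (hy : y < n) (hz : z < n) (hp : p < n) :
    (isTriple x y z p n).Realize v ↔ Triple (v x) (v y) (v z) (v p) := by
  simp (disch := omega) only [isTriple, Triple, realize_ex, realize_conj, realize_isPair,
    Function.update_self, Function.update_of_ne]

theorem realize_isSucc (hx : x < n) (hy : y < n) :
    (isSucc x y n).Realize v ↔ Suc (v x) (v y) := by
  simp (disch := omega) only [isSucc, Suc, realize_all, realize_equiv, realize_disj, realize_mem,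
    realize_eq, Function.update_self, Function.update_of_ne]

theorem realize_isNat (hx : x < n) : (isNat x n).Realize v ↔ NatOrd (v x) := by
  simp (disch := omega) only [isNat, isOrd, isTrans, isSuccessor, NatOrd, realize_all, realize_imp,
    realize_conj, realize_disj, realize_mem, realize_eq, realize_allIn, realize_exIn,
    realize_isEmpty, realize_isSucc, realize_subset, Function.update_self, Function.update_of_ne]

theorem realize_isNumeral (k : ℕ) {n x : ℕ} (v : ℕ → M) (hx : x < n) :
    (isNumeral k x n).Realize v ↔ Numeral k (v x) := by
  induction k generalizing n x v with
  | zero => exact realize_isEmpty v hx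
  | succ k ih =>
    simp (disch := omega) only [isNumeral, Numeral, realize_ex, realize_conj, ih, realize_isSucc,
      Function.update_self, Function.update_of_ne]

theorem realize_app (hz : z < n) (hx : x < n) (hy : y < n) :
    (app z x y n).Realize v ↔ App (v z) (v x) (v y) := by
  simp (disch := omega) only [app, App, realize_exIn, realize_isPair,
    Function.update_self, Function.update_of_ne]

theorem realize_isFun (hx : x < n) (hy : y < n) (hz : z < n) :
    (isFun x y z n).Realize v ↔ Fun (v x) (v y) (v z) := by
  simp (disch := omega) only [isFun, Fun, realize_conj, realize_all, realize_imp, realize_allIn,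
    realize_exIn, realize_isPair, realize_app, realize_eq, Function.update_self,
    Function.update_of_ne]

theorem realize_isFunOn (hx : x < n) (hy : y < n) :
    (isFunOn x y n).Realize v ↔ FunOn (v x) (v y) := by
  simp (disch := omega) only [isFunOn, FunOn, realize_conj, realize_all, realize_imp, realize_allIn,
    realize_exIn, realize_ex, realize_isPair, realize_app, realize_eq, Function.update_self,
    Function.update_of_ne]

end
end Realize

/-! ## Coded formulas and satisfaction, read in a structure -/

section Satisfaction

variable {M : Type*} [LSet.Structure M]

def Var (i t : M) : Prop := ∃ o, Numeral 0 o ∧ Pair o i t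
def Const (a t : M) : Prop := ∃ o, Numeral 1 o ∧ Pair o a t
def Code₁ (c : ℕ) (t x : M) : Prop := ∃ o, Numeral c o ∧ Pair o t x
def Code₂ (c : ℕ) (s t x : M) : Prop := ∃ o, Numeral c o ∧ Triple o s t x
def IsTerm (A m t : M) : Prop := (∃ i, E i m ∧ Var i t) ∨ ∃ a, E a A ∧ Const a t
def Atomic (u r : Bool) (A m x : M) : Prop :=
  (∃ s t, IsTerm A m s ∧ IsTerm A m t ∧ Code₂ 2 s t x) ∨
  (u = true ∧ ∃ t, IsTerm A m t ∧ Code₁ 6 t x) ∨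
  (r = true ∧ ∃ s t, IsTerm A m s ∧ IsTerm A m t ∧ Code₂ 7 s t x)
def Formation (u r : Bool) (A m x f n : M) : Prop :=
  NatOrd n ∧ FunOn f n ∧ (∃ k, E k n ∧ Suc k n ∧ App f k x) ∧
  ∀ k, E k n → ∃ y, App f k y ∧
    (Atomic u r A m y ∨
     (∃ j, E j k ∧ ∃ z, App f j z ∧ Code₁ 3 z y) ∨
     (∃ j, E j k ∧ ∃ l, E l k ∧ ∃ z w, App f j z ∧ App f l w ∧ Code₂ 4 z w y) ∨
     (∃ j, E j k ∧ ∃ i, E i m ∧ ∃ z, App f j z ∧ Code₂ 5 i z y))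
def SeqEntry (s i x : M) : Prop :=
  ∃ p, Pair i x p ∧ ((Emp i ∧ App s i p) ∨
    ∃ j, E j i ∧ Suc j i ∧ ∃ q t, App s j q ∧ Pair q p t ∧ App s i t)
def TupleVia (n h s : M) : Prop :=
  FunOn s n ∧ (∃ k, E k n ∧ Suc k n ∧ App s k h) ∧ ∀ i, E i n → ∃ x, SeqEntry s i x
def Entry (n h i x : M) : Prop := ∃ s, TupleVia n h s ∧ E i n ∧ SeqEntry s i x
def Assign (n D h : M) : Prop :=
  (Emp n ∧ Emp h) ∨ ∃ s, TupleVia n h s ∧ ∀ i, E i n → ∃ x, E x D ∧ SeqEntry s i x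
def Value (A I m h t y : M) : Prop :=
  (∃ i, E i m ∧ Var i t ∧ Entry m h i y) ∨ ∃ a, E a A ∧ Const a t ∧ App I a y
def AssignSet (m D G : M) (P : M → Prop) : Prop := ∀ h, E h G ↔ Assign m D h ∧ P h
def SatClause (u r : Bool) (A D U R I m f g k x G : M) : Prop :=
  (∃ s t, Code₂ 2 s t x ∧ AssignSet m D G fun h => ∃ y, Value A I m h s y ∧ Value A I m h t y) ∨
  (u = true ∧ ∃ t, Code₁ 6 t x ∧ AssignSet m D G fun h => ∃ y, E y U ∧ Value A I m h t y) ∨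
  (r = true ∧ ∃ s t, Code₂ 7 s t x ∧ AssignSet m D G fun h =>
    ∃ y z, Value A I m h s y ∧ Value A I m h t z ∧ App R y z) ∨
  (∃ j, E j k ∧ ∃ z H, App f j z ∧ App g j H ∧ Code₁ 3 z x ∧ AssignSet m D G fun h => ¬ E h H) ∨
  (∃ j, E j k ∧ ∃ l, E l k ∧ ∃ z w H K, App f j z ∧ App f l w ∧ App g j H ∧ App g l K ∧
    Code₂ 4 z w x ∧ AssignSet m D G fun h => E h H ∧ E h K) ∨
  (∃ j, E j k ∧ ∃ i, E i m ∧ ∃ z H, App f j z ∧ App g j H ∧ Code₂ 5 i z x ∧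
    AssignSet m D G fun h => ∃ h', E h' H ∧
      ∀ l, E l m → ¬ l = i → ∀ y, Entry m h l y ↔ Entry m h' l y)
def Sat (u r : Bool) (A D U R I m x e : M) : Prop :=
  ∃ f g n, Formation u r A m x f n ∧ FunOn g n ∧
    (∀ k, E k n → ∃ y G, App f k y ∧ App g k G ∧ SatClause u r A D U R I m f g k y G) ∧
    ∃ k, E k n ∧ Suc k n ∧ ∃ G, App g k G ∧ E e G
def Coded : (u r : Bool) → (D U R I S : M) → Prop
  | true, true, D, U, R, I, S => ∃ q, Triple D U R q ∧ Pair q I S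
  | true, false, D, U, R, I, S => Emp R ∧ Triple D U I S
  | false, true, D, U, R, I, S => Emp U ∧ Triple D R I S
  | false, false, D, U, R, I, S => Emp U ∧ Emp R ∧ Pair D I S
def StructureWith (u r : Bool) (A D U R I S : M) : Prop :=
  Coded u r D U R I S ∧ Sub U D ∧ (∀ p, E p R → ∃ x, E x D ∧ ∃ y, E y D ∧ Pair x y p) ∧ Fun I A D
def ElemEmb (u r : Bool) (A S T f : M) : Prop :=
  ∃ D U R I D' U' R' I', StructureWith u r A D U R I S ∧ StructureWith u r A D' U' R' I' T ∧
    Fun f D D' ∧ (∀ x y z, App f x z ∧ App f y z → x = y) ∧ (Emp D → Emp D') ∧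
    ∀ m x d e, NatOrd m ∧ (∃ g n, Formation u r A m x g n) ∧ Assign m D d ∧ Assign m D' e ∧
      (∀ i, E i m → ∀ y z, Entry m d i y ∧ App f y z → Entry m e i z) →
      (Sat u r A D U R I m x d ↔ Sat u r A D' U' R' I' m x e)

section
variable {n x y z p A m t i : ℕ} (v : ℕ → M)

theorem realize_isVar (hx : x < n) (hy : y < n) :
    (isVar x y n).Realize v ↔ Var (v x) (v y) := by
  simp (disch := omega) only [isVar, Var, realize_ex, realize_conj, realize_isNumeral,
    realize_isPair, Function.update_self, Function.update_of_ne]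

theorem realize_isConst (hx : x < n) (hy : y < n) :
    (isConst x y n).Realize v ↔ Const (v x) (v y) := by
  simp (disch := omega) only [isConst, Const, realize_ex, realize_conj, realize_isNumeral,
    realize_isPair, Function.update_self, Function.update_of_ne]

theorem realize_isCode₁ (c : ℕ) (hx : x < n) (hy : y < n) :
    (isCode₁ c x y n).Realize v ↔ Code₁ c (v x) (v y) := by
  simp (disch := omega) only [isCode₁, Code₁, realize_ex, realize_conj, realize_isNumeral,
    realize_isPair, Function.update_self, Function.update_of_ne]

theorem realize_isCode₂ (c : ℕ) (hx : x < n) (hy : y < n) (hz : z < n) :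
    (isCode₂ c x y z n).Realize v ↔ Code₂ c (v x) (v y) (v z) := by
  simp (disch := omega) only [isCode₂, Code₂, realize_ex, realize_conj, realize_isNumeral,
    realize_isTriple, Function.update_self, Function.update_of_ne]

theorem realize_isTerm (hA : A < n) (hm : m < n) (ht : t < n) :
    (isTerm A m t n).Realize v ↔ IsTerm (v A) (v m) (v t) := by
  simp (disch := omega) only [isTerm, IsTerm, realize_disj, realize_exIn, realize_isVar,
    realize_isConst, Function.update_self, Function.update_of_ne]

theorem realize_isAtomic (u r : Bool) (hA : A < n) (hm : m < n) (hx : x < n) :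
    (isAtomic u r A m x n).Realize v ↔ Atomic u r (v A) (v m) (v x) := by
  simp (disch := omega) only [isAtomic, Atomic, realize_disj, realize_ex, realize_conj,
    realize_onlyIf, realize_isTerm, realize_isCode₁, realize_isCode₂, Function.update_self,
    Function.update_of_ne]

theorem realize_isFormation (u r : Bool) {f k : ℕ} (hA : A < n) (hm : m < n) (hx : x < n)
    (hf : f < n) (hk : k < n) :
    (isFormation u r A m x f k n).Realize v ↔
      Formation u r (v A) (v m) (v x) (v f) (v k) := by
  simp (disch := omega) only [isFormation, Formation, realize_disj, realize_ex, realize_conj,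
    realize_exIn, realize_allIn, realize_isNat, realize_isFunOn, realize_isSucc, realize_app,
    realize_isAtomic, realize_isCode₁, realize_isCode₂, Function.update_self,
    Function.update_of_ne]

theorem realize_seqEntry (hx : x < n) (hi : i < n) (hy : y < n) :
    (seqEntry x i y n).Realize v ↔ SeqEntry (v x) (v i) (v y) := by
  simp (disch := omega) only [seqEntry, SeqEntry, realize_disj, realize_ex, realize_conj,
    realize_exIn, realize_isEmpty, realize_isSucc, realize_app, realize_isPair,
    Function.update_self, Function.update_of_ne]

theorem realize_isTupleVia (hx : x < n) (hi : i < n) (hy : y < n) :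
    (isTupleVia x i y n).Realize v ↔ TupleVia (v x) (v i) (v y) := by
  simp (disch := omega) only [isTupleVia, TupleVia, realize_ex, realize_conj, realize_exIn,
    realize_allIn, realize_isFunOn, realize_isSucc, realize_app, realize_seqEntry,
    Function.update_self, Function.update_of_ne]

theorem realize_entry (hx : x < n) (hi : i < n) (hy : y < n) (hz : z < n) :
    (entry x y i z n).Realize v ↔ Entry (v x) (v y) (v i) (v z) := by
  simp (disch := omega) only [entry, Entry, realize_ex, realize_conj, realize_mem,
    realize_isTupleVia, realize_seqEntry, Function.update_self, Function.update_of_ne]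

theorem realize_isAssign (hx : x < n) (hy : y < n) (hz : z < n) :
    (isAssign x y z n).Realize v ↔ Assign (v x) (v y) (v z) := by
  simp (disch := omega) only [isAssign, Assign, realize_ex, realize_conj, realize_disj,
    realize_isEmpty, realize_allIn, realize_exIn, realize_isTupleVia, realize_seqEntry,
    Function.update_self, Function.update_of_ne]

theorem realize_isValue {I : ℕ} (hA : A < n) (hI : I < n) (hm : m < n) (hx : x < n) (ht : t < n)
    (hy : y < n) :
    (isValue A I m x t y n).Realize v ↔ Value (v A) (v I) (v m) (v x) (v t) (v y) := by
  simp (disch := omega) only [isValue, Value, realize_conj, realize_disj, realize_exIn,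
    realize_isVar, realize_entry, realize_isConst, realize_app, Function.update_self,
    Function.update_of_ne]

theorem realize_isAssignSet (hx : x < n) (hy : y < n) (hz : z < n) (F : ℕ → Fm) :
    (isAssignSet x y z F n).Realize v ↔
      AssignSet (v x) (v y) (v z) fun h => (F n (n + 1)).Realize (Function.update v n h) := by
  simp (disch := omega) only [isAssignSet, AssignSet, realize_all, realize_equiv, realize_conj,
    realize_mem, realize_isAssign, Function.update_self, Function.update_of_ne]

theorem realize_satClause (u r : Bool) {D U R I f g k G : ℕ} (hA : A < n) (hD : D < n) (hU : U < n)
    (hR : R < n) (hI : I < n) (hm : m < n) (hf : f < n) (hg : g < n) (hk : k < n) (hx : x < n)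
    (hG : G < n) :
    (satClause u r A D U R I m f g k x G n).Realize v ↔
      SatClause u r (v A) (v D) (v U) (v R) (v I) (v m) (v f) (v g) (v k) (v x) (v G) := by
  simp (disch := omega) only [satClause, SatClause, realize_ex, realize_conj, realize_disj,
    realize_all, realize_imp, realize_neg, realize_mem, realize_eq, realize_equiv,
    realize_onlyIf, realize_allIn, realize_exIn, realize_isCode₁, realize_isCode₂,
    realize_isAssignSet, realize_isValue, realize_app, realize_entry,
    Function.update_self, Function.update_of_ne]

theorem realize_sat (u r : Bool) {D U R I e : ℕ} (hA : A < n) (hD : D < n) (hU : U < n)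
    (hR : R < n) (hI : I < n) (hm : m < n) (hx : x < n) (he : e < n) :
    (sat u r A D U R I m x e n).Realize v ↔
      Sat u r (v A) (v D) (v U) (v R) (v I) (v m) (v x) (v e) := by
  simp (disch := omega) only [sat, Sat, realize_ex, realize_conj, realize_mem, realize_allIn,
    realize_exIn, realize_isFormation, realize_isFunOn, realize_isSucc, realize_app,
    realize_satClause, Function.update_self, Function.update_of_ne]

theorem realize_isStructureWith (u r : Bool) {D U R I S : ℕ} (hA : A < n) (hD : D < n) (hU : U < n)
    (hR : R < n) (hI : I < n) (hS : S < n) :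
    (isStructureWith u r A D U R I S n).Realize v ↔
      StructureWith u r (v A) (v D) (v U) (v R) (v I) (v S) := by
  have h : (isCoded u r D U R I S n).Realize v ↔
      Coded u r (v D) (v U) (v R) (v I) (v S) := by
    cases u <;> cases r <;>
    simp (disch := omega) only [isCoded, isQuadruple, Coded, realize_ex, realize_conj,
      realize_isEmpty, realize_isTriple, realize_isPair, Function.update_self,
      Function.update_of_ne]
  simp (disch := omega) only [isStructureWith, StructureWith, realize_conj, h, realize_allIn,
    realize_exIn, realize_subset, realize_isPair, realize_isFun, Function.update_self,
    Function.update_of_ne]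

theorem realize_isStructure (u r : Bool) {S : ℕ} (hA : A < n) (hS : S < n) :
    (isStructure u r A S n).Realize v ↔
      ∃ D U R I, StructureWith u r (v A) D U R I (v S) := by
  simp (disch := omega) only [isStructure, realize_ex, realize_isStructureWith,
    Function.update_self, Function.update_of_ne]

theorem realize_isElemEmb (u r : Bool) {S T f : ℕ} (hA : A < n) (hS : S < n) (hT : T < n)
    (hf : f < n) :
    (isElemEmb u r A S T f n).Realize v ↔ ElemEmb u r (v A) (v S) (v T) (v f) := by
  simp (disch := omega) only [isElemEmb, ElemEmb, isInj, isFormula, realize_ex, realize_conj,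
    realize_all, realize_imp, realize_equiv, realize_eq, realize_allIn, realize_isStructureWith,
    realize_isFun, realize_app, realize_isEmpty, realize_isNat, realize_isFormation,
    realize_isAssign, realize_entry, realize_sat, Function.update_self, Function.update_of_ne]

end
end Satisfaction

/-! ## The axioms, read in a structure -/

section Axioms

/-! ### Natural numbers in a structure -/

section

variable {M : Type*} [LSet.Structure M]

/-- Together with `NatOrd.suc`, this supplies the `Nat` half of the base and successor cases of
induction along ω. It also makes 0 and 1 available as a number of variables and as the length of a
formation sequence. -/
theorem Emp.natOrd {x : M} (h : Emp x) : NatOrd x :=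
  ⟨⟨fun y hy => (h y hy).elim, fun y hy => (h y hy).elim⟩, by
    rintro y (hy | rfl)
    · exact (h y hy).elim
    · exact .inl h⟩

theorem NatOrd.suc {x y : M} (h : NatOrd x) (hy : Suc x y) : NatOrd y := by
  obtain ⟨⟨ht, hl⟩, hs⟩ := h
  have hxy := (hy x).2 (.inr rfl)
  refine ⟨⟨fun z hz w hw => ?_, fun z hz w hw => ?_⟩, ?_⟩
  · rcases (hy z).1 hz with hz | rfl
    · exact (hy w).2 (.inl (ht z hz w hw))
    · exact (hy w).2 (.inl hw)
  · rcases (hy z).1 hz with hz | rfl <;> rcases (hy w).1 hw with hw | rfl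
    · exact hl z hz w hw
    · exact .inl hz
    · exact .inr (.inr hw)
    · exact .inr (.inl rfl)
  · rintro z (hz | rfl)
    · exact hs z ((hy z).1 hz)
    · exact .inr ⟨x, hxy, hy⟩

end

/-- The consequences of `EST + VP` used in the proof of the powerset axiom. -/
structure Facts (M : Type*) [LSet.Structure M] : Prop where
  ext : ∀ x y : M, (∀ z, E z x ↔ E z y) → x = y
  empty : ∃ x : M, Emp x
  upair : ∀ x y : M, ∃ p, UPair x y p
  union : ∀ x : M, ∃ u, ∀ z, E z u ↔ ∃ y, E y x ∧ E z y
  prod : ∀ A B : M, ∃ P, ∀ p, E p P ↔ ∃ x, E x A ∧ ∃ y, E y B ∧ Pair x y p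
  sepSub : ∀ A a : M, ∃ b, ∀ x, E x b ↔ E x a ∧ Sub x A
  sepSubsingleton : ∀ a : M, ∃ b, ∀ x, E x b ↔ E x a ∧ ∀ s, E s x → ∀ t, E t x → s = t
  ind : (∀ x : M, Emp x → ¬ E x x ∧ ∀ k l, Suc k x → Suc l x → k = l) →
    (∀ x y : M, NatOrd x → NatOrd y → Suc x y → (¬ E x x ∧ ∀ k l, Suc k x → Suc l x → k = l) →
      ¬ E y y ∧ ∀ k l, Suc k y → Suc l y → k = l) →
    ∀ x : M, NatOrd x → ¬ E x x ∧ ∀ k l, Suc k x → Suc l x → k = l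
  vp : ∀ A I : M,
    (∀ y, (∃ X, Sub X A ∧ Triple A X I y) → ∃ D U R J, StructureWith true false A D U R J y) →
    (∀ x, ∃ y, ((∃ X, Sub X A ∧ Triple A X I y) ∧ ¬ E y x) ∨
      (¬ (∃ X, Sub X A ∧ Triple A X I y) ∧ E y x)) →
    ∃ S T, (∃ X, Sub X A ∧ Triple A X I S) ∧ (∃ X, Sub X A ∧ Triple A X I T) ∧ S ≠ T ∧
      ∃ f, ElemEmb true false A S T f

/-- The formula of `x₀, …, xₖ` with parameters `x₀, …, xₖ₋₁` and argument `xₖ`. -/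
def ofFm (k : ℕ) (F : Fm) : LSet.Formula (Fin k ⊕ Fin 1) :=
  (F (k + 1)).relabel fun i => if h : i < k then Sum.inl ⟨i, h⟩ else Sum.inr 0

variable {M : Type*} [LSet.Structure M]

theorem realize_ofFm (k : ℕ) (F : Fm) (p : Fin k → M) (y : Fin 1 → M) :
    (ofFm k F).Realize (Sum.elim p y) ↔
      (F (k + 1)).Realize fun i => if h : i < k then p ⟨i, h⟩ else y 0 := by
  unfold ofFm
  rw [Formula.realize_relabel]
  have : (Sum.elim p y ∘ fun i => if h : i < k then Sum.inl ⟨i, h⟩ else Sum.inr 0) =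
      fun i => if h : i < k then p ⟨i, h⟩ else y 0 := by
    funext i
    by_cases h : i < k <;> simp [h]
  rw [this]

/-- The `Δ₀` formula `x ⊆ p`, with parameter `p`. -/
def subsetFormula : LSet.Formula (Fin 1 ⊕ Fin 1) :=
  BoundedFormula.all ((Relations.boundedFormula₂ (L := LSet) SetRel.mem
    (Term.var (Sum.inr (Fin.last 0)))
    ((Term.var (Sum.inl (Sum.inr 0)) : LSet.Term ((Fin 1 ⊕ Fin 1) ⊕ Fin 0)).relabel
      (Sum.map id Fin.castSucc))).imp
    (Relations.boundedFormula₂ (L := LSet) SetRel.mem (Term.var (Sum.inr (Fin.last 0)))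
      (Term.var (Sum.inl (Sum.inl 0)))))

theorem isDelta0_subsetFormula : IsDelta0 subsetFormula :=
  .ballMem _ (.rel _ _)

theorem realize_subsetFormula (p x : Fin 1 → M) :
    subsetFormula.Realize (Sum.elim p x) ↔ Sub (x 0) (p 0) := by
  simp [subsetFormula, Formula.Realize, BoundedFormula.realize_rel₂, Sub, E, Fin.snoc]

/-- The `Δ₀` formula saying that any two elements of `x` are equal. -/
def subsingletonFormula : LSet.Formula (Fin 0 ⊕ Fin 1) :=
  BoundedFormula.all ((Relations.boundedFormula₂ (L := LSet) SetRel.mem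
    (Term.var (Sum.inr (Fin.last 0)))
    ((Term.var (Sum.inl (Sum.inr 0)) : LSet.Term ((Fin 0 ⊕ Fin 1) ⊕ Fin 0)).relabel
      (Sum.map id Fin.castSucc))).imp
    (BoundedFormula.all ((Relations.boundedFormula₂ (L := LSet) SetRel.mem
      (Term.var (Sum.inr (Fin.last 1)))
      ((Term.var (Sum.inl (Sum.inr 0)) : LSet.Term ((Fin 0 ⊕ Fin 1) ⊕ Fin 1)).relabel
        (Sum.map id Fin.castSucc))).imp
      (BoundedFormula.equal (Term.var (Sum.inr 0)) (Term.var (Sum.inr 1))))))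

theorem isDelta0_subsingletonFormula : IsDelta0 subsingletonFormula :=
  .ballMem _ (.ballMem _ (.equal _ _))

theorem realize_subsingletonFormula (p : Fin 0 → M) (x : Fin 1 → M) :
    subsingletonFormula.Realize (Sum.elim p x) ↔
      ∀ s, E s (x 0) → ∀ t, E t (x 0) → s = t := by
  simp [subsingletonFormula, Formula.Realize, BoundedFormula.realize_rel₂, E, Fin.snoc,
    BoundedFormula.Realize]

theorem facts_of_model {M : Type*} [LSet.Structure M] [Nonempty M] (h : M ⊨ EST ∪ VP) :
    Facts M := by
  have est₀ : ∀ σ ∈ EST₀, M ⊨ σ := fun σ hσ => h.realize_of_mem σ (.inl (.inl hσ))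
  have hE : ∀ σ ∈ ({axExt, axEmpty, axPair, axUnion, axCartProd} : LSet.Theory), M ⊨ σ :=
    fun σ hσ => est₀ σ (.inl hσ)
  -- A closure without parameters still carries one idle quantifier, which any value may
  -- instantiate.
  have c0 : Fin (0 + 1) → M := fun _ => Classical.arbitrary M
  constructor
  · have := hE axExt (by simp)
    unfold axExt at this
    rw [realize_close] at this
    have := this c0
    simpa (disch := omega) only [realize_all, realize_imp, realize_equiv, realize_mem, realize_eq,
      Function.update_self, Function.update_of_ne] using this
  · have := hE axEmpty (by simp)
    unfold axEmpty at this
    rw [realize_close] at this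
    have := this c0
    simpa (disch := omega) only [realize_ex, realize_isEmpty,
      Function.update_self, Function.update_of_ne] using this
  · have := hE axPair (by simp)
    unfold axPair at this
    rw [realize_close] at this
    have := this c0
    simpa (disch := omega) only [realize_all, realize_ex, realize_isUPair,
      Function.update_self, Function.update_of_ne] using this
  · have := hE axUnion (by simp)
    unfold axUnion at this
    rw [realize_close] at this
    have := this c0
    simpa (disch := omega) only [realize_all, realize_ex, realize_equiv, realize_exIn, realize_mem,
      Function.update_self, Function.update_of_ne] using this
  · have := hE axCartProd (by simp)
    unfold axCartProd at this
    rw [realize_close] at this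
    have := this c0
    simpa (disch := omega) only [realize_all, realize_ex, realize_equiv, realize_exIn, realize_mem,
      realize_isPair, Function.update_self, Function.update_of_ne] using this
  · intro A
    have := est₀ (axSep subsetFormula) (.inr ⟨_, _, isDelta0_subsetFormula, rfl⟩)
    unfold axSep at this
    rw [realize_close] at this
    have := this fun _ => A
    simpa (disch := omega) only [realize_all, realize_ex, realize_equiv, realize_conj, realize_mem,
      realize_inst, realize_subsetFormula, Function.comp_apply, Matrix.cons_val_zero, Fin.val_zero,
      Function.update_self, Function.update_of_ne] using this
  · have := est₀ (axSep subsingletonFormula) (.inr ⟨_, _, isDelta0_subsingletonFormula, rfl⟩)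
    unfold axSep at this
    rw [realize_close] at this
    have := this c0
    simpa (disch := omega) only [realize_all, realize_ex, realize_equiv, realize_conj, realize_mem,
      realize_inst, realize_subsingletonFormula, Function.comp_apply, Matrix.cons_val_zero,
      Function.update_self, Function.update_of_ne] using this
  · intro h₀ h₁
    -- Including `isNat` as a conjunct makes the premise that the formula defines a subclass of ω
    -- immediate.
    have := h.realize_of_mem _ (.inl (.inr ⟨0, ofFm 0 (isNat 0 ⋏ neg (0 ε 0) ⋏
      all fun k => all fun l => isSucc k 0 ⇒ isSucc l 0 ⇒ k ≐ l), rfl⟩))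
    unfold axInd at this
    rw [realize_close] at this
    have := this c0
    simp (disch := omega) only [realize_all, realize_imp, realize_conj, realize_neg, realize_mem,
      realize_eq, realize_isNat, realize_isSucc, realize_isEmpty,
      realize_inst, realize_ofFm, Function.comp_apply, Matrix.cons_val_zero, not_lt_zero, dite_false,
      Function.update_self, Function.update_of_ne] at this
    exact fun x hx => (this (fun _ h => h.1) ⟨fun x hx => ⟨hx.natOrd, h₀ x hx⟩,
      fun x hx hx' y hy => ⟨hx.suc hy, h₁ x y hx (hx.suc hy) hy hx'.2⟩⟩ x hx).2
  · intro A I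
    have := h.realize_of_mem _ (.inr ⟨true, false, 2,
      ofFm 2 (ex fun X => subset X 0 ⋏ isTriple 0 X 1 2), rfl⟩)
    unfold axVP at this
    rw [realize_close] at this
    -- The first two entries are the parameters of the class. The third fills the idle variable and
    -- is overwritten by the quantifier over the set of constants, which is instantiated with `A` at
    -- the end.
    have := this ![A, I, A]
    simp (disch := omega) only [realize_all, realize_ex, realize_imp, realize_conj, realize_disj,
      realize_neg, realize_mem, realize_eq, realize_isStructure, realize_isElemEmb, realize_subset,
      realize_isTriple, realize_inst, realize_ofFm, Function.comp_apply, Matrix.cons_val_zero,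
      Function.update_self, Function.update_of_ne] at this
    exact fun h₁ h₂ => this A ⟨h₁, h₂⟩

end Axioms

/-! ## Pairs, numerals, singleton functions -/

section SetTheory

variable {M : Type*} [LSet.Structure M]

/-- Extensionality is not needed: the witnesses for both readings are members of the same `p`, so
each of `s`, `t` is one of `s'`, `t'` and conversely, and comparing their elements gives the
coordinates. -/
theorem Pair.inj {x y x' y' p : M} (h : Pair x y p) (h' : Pair x' y' p) : x = x' ∧ y = y' := by
  obtain ⟨s, t, hs, ht, hp⟩ := h
  obtain ⟨s', t', hs', ht', hp'⟩ := h'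
  have e1 := (hp' s).1 ((hp s).2 (.inl rfl))
  have e2 := (hp' t).1 ((hp t).2 (.inr rfl))
  have e3 := (hp t').1 ((hp' t').2 (.inr rfl))
  have hx : x = x' := by
    rcases e1 with rfl | rfl
    · simpa using (hs' x).1 ((hs x).2 (.inl rfl))
    · simpa [eq_comm] using (hs x').1 ((ht' x').2 (.inl rfl))
  subst hx
  refine ⟨rfl, ?_⟩
  have f1 := (ht y).2 (.inr rfl)
  have f2 := (ht' y').2 (.inr rfl)
  rcases e2 with rfl | rfl
  · have g1 := (hs' y).1 f1
    rcases e3 with rfl | rfl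
    · have g2 := (hs y').1 f2
      grind
    · have g2 := (hs' y').1 f2
      grind
  · have g1 := (ht' y).1 f1
    have g2 := (ht y').1 f2
    grind

theorem Triple.inj {x y z x' y' z' p : M} (h : Triple x y z p) (h' : Triple x' y' z' p) :
    x = x' ∧ y = y' ∧ z = z' := by
  obtain ⟨q, hq, hp⟩ := h
  obtain ⟨q', hq', hp'⟩ := h'
  obtain ⟨rfl, rfl⟩ := hp.inj hp'
  obtain ⟨rfl, rfl⟩ := hq.inj hq'
  exact ⟨rfl, rfl, rfl⟩

theorem UPair.unique (F : Facts M) {x y p q : M} (h : UPair x y p) (h' : UPair x y q) : p = q :=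
  F.ext _ _ fun z => (h z).trans (h' z).symm

theorem Pair.unique (F : Facts M) {x y p q : M} (h : Pair x y p) (h' : Pair x y q) : p = q := by
  obtain ⟨s, t, hs, ht, hp⟩ := h
  obtain ⟨s', t', hs', ht', hp'⟩ := h'
  obtain rfl := hs.unique F hs'
  obtain rfl := ht.unique F ht'
  exact hp.unique F hp'

theorem Triple.unique (F : Facts M) {x y z p q : M} (h : Triple x y z p) (h' : Triple x y z q) :
    p = q := by
  obtain ⟨a, ha, hp⟩ := h
  obtain ⟨b, hb, hq⟩ := h'
  obtain rfl := ha.unique F hb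
  exact hp.unique F hq

theorem Emp.unique (F : Facts M) {x y : M} (h : Emp x) (h' : Emp y) : x = y :=
  F.ext _ _ fun z => iff_of_false (h z) (h' z)

theorem Suc.unique (F : Facts M) {x y z : M} (h : Suc x y) (h' : Suc x z) : y = z :=
  F.ext _ _ fun w => (h w).trans (h' w).symm

theorem Numeral.unique (F : Facts M) {k : ℕ} {x y : M} (h : Numeral k x) (h' : Numeral k y) :
    x = y := by
  induction k generalizing x y with
  | zero => exact Emp.unique F h h'
  | succ k ih =>
    obtain ⟨z, hz, hx⟩ := h
    obtain ⟨w, hw, hy⟩ := h'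
    obtain rfl := ih hz hw
    exact hx.unique F hy

theorem numeral_mem_iff (F : Facts M) {k : ℕ} {x : M} (h : Numeral k x) (z : M) :
    E z x ↔ ∃ j < k, Numeral j z := by
  induction k generalizing x with
  | zero => simpa using h z
  | succ k ih =>
    obtain ⟨y, hy, hx⟩ := h
    rw [hx z, ih hy]
    constructor
    · rintro (⟨j, hj, hz⟩ | rfl)
      · exact ⟨j, by omega, hz⟩
      · exact ⟨k, by omega, hy⟩
    · rintro ⟨j, hj, hz⟩
      rcases Nat.lt_succ_iff_lt_or_eq.1 hj with hj | rfl
      · exact .inl ⟨j, hj, hz⟩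
      · exact .inr (hz.unique F hy)

/-- If `x` were both the numeral k and the numeral l with k < l, then x ∈ x, so `x` would also be a
numeral j with j < k. This is an infinite descent in the external natural numbers. -/
theorem Numeral.inj (F : Facts M) {k l : ℕ} {x : M} (hk : Numeral k x) (hl : Numeral l x) : k = l := by
  have key : ∀ k l : ℕ, k < l → Numeral k x → Numeral l x → False := by
    intro k
    induction k using Nat.strong_induction_on with
    | _ k ih =>
      intro l hkl hk hl
      obtain ⟨j, hj, hjx⟩ := (numeral_mem_iff F hk x).1 ((numeral_mem_iff F hl x).2 ⟨k, hkl, hk⟩)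
      exact ih j hj k hj hjx hk
  rcases lt_trichotomy k l with h | h | h
  · exact (key k l h hk hl).elim
  · exact h
  · exact (key l k h hl hk).elim

theorem Pair.not_emp_mem {x y p z : M} (h : Pair x y p) (hz : E z p) : ¬ Emp z := by
  obtain ⟨s, t, hs, ht, hp⟩ := h
  rcases (hp z).1 hz with rfl | rfl
  · exact fun he => he x ((hs x).2 (.inl rfl))
  · exact fun he => he x ((ht x).2 (.inl rfl))

/-! ### Existence of pairs, numerals and simple functions -/

theorem exists_pair (F : Facts M) (x y : M) : ∃ p, Pair x y p := by
  obtain ⟨s, hs⟩ := F.upair x x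
  obtain ⟨t, ht⟩ := F.upair x y
  obtain ⟨p, hp⟩ := F.upair s t
  exact ⟨p, s, t, hs, ht, hp⟩

theorem exists_suc (F : Facts M) (x : M) : ∃ y, Suc x y := by
  obtain ⟨s, hs⟩ := F.upair x x
  obtain ⟨t, ht⟩ := F.upair x s
  obtain ⟨u, hu⟩ := F.union t
  refine ⟨u, fun z => (hu z).trans ⟨?_, ?_⟩⟩
  · rintro ⟨y, hy, hz⟩
    rcases (ht y).1 hy with rfl | rfl
    · exact .inl hz
    · exact .inr (by simpa using (hs z).1 hz)
  · rintro (hz | rfl)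
    · exact ⟨x, (ht x).2 (.inl rfl), hz⟩
    · exact ⟨s, (ht s).2 (.inr rfl), (hs z).2 (.inl rfl)⟩

theorem exists_numeral (F : Facts M) (k : ℕ) : ∃ x : M, Numeral k x := by
  induction k with
  | zero => exact F.empty
  | succ k ih =>
    obtain ⟨x, hx⟩ := ih
    obtain ⟨y, hy⟩ := exists_suc F x
    exact ⟨y, x, hx, hy⟩

/-- Uniqueness of predecessors follows from x ∉ x: if x ∪ {x} = k ∪ {k} with k ≠ x, then k ∈ x and x
∈ k, so x ∈ x by transitivity. Irreflexivity is carried along in the same induction, where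
transitivity turns y ∈ y for y = x ∪ {x} back into x ∈ x. -/
theorem Suc.inj_of_natOrd {x k l : M} (F : Facts M) (h : NatOrd x) (hk : Suc k x) (hl : Suc l x) :
    k = l := by
  have key : ∀ x y : M, NatOrd x → ¬ E x x → Suc x y → ∀ k, Suc k y → k = x := by
    intro x y hx hxx hy k hk
    rcases (hy k).1 ((hk k).2 (.inr rfl)) with h₁ | h₁
    · rcases (hk x).1 ((hy x).2 (.inr rfl)) with h₂ | h₂
      · exact (hxx (hx.1.1 k h₁ x h₂)).elim
      · exact h₂.symm
    · exact h₁
  refine (F.ind (fun x hx => ⟨hx x, fun k l hk => (hx k ((hk k).2 (.inr rfl))).elim⟩)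
    (fun x y hx hy hxy ih => ⟨fun hyy => ?_, fun k l hk hl => ?_⟩) x h).2 k l hk hl
  · rcases (hxy y).1 hyy with h | rfl
    · exact ih.1 (hx.1.1 y h x ((hxy x).2 (.inr rfl)))
    · exact ih.1 hyy
  · rw [key x y hx ih.1 hxy k hk, key x y hx ih.1 hxy l hl]

/-- The function `{⟨z, y⟩}` on `{z}`. -/
theorem exists_singleton_fun (F : Facts M) {z n : M} (hn : UPair z z n) (y : M) :
    ∃ f, FunOn f n ∧ ∀ k w, App f k w ↔ k = z ∧ w = y := by
  obtain ⟨p, hp⟩ := exists_pair F z y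
  obtain ⟨f, hf⟩ := F.upair p p
  simp only [UPair, or_self] at hf hn
  have happ : ∀ k w, App f k w ↔ k = z ∧ w = y := by
    refine fun k w => ⟨?_, ?_⟩
    · rintro ⟨q, hq, hkw⟩
      obtain rfl := (hf q).1 hq
      exact hkw.inj hp
    · rintro ⟨rfl, rfl⟩
      exact ⟨p, (hf p).2 rfl, hp⟩
  refine ⟨f, ⟨fun q hq => ?_, fun k hk => ?_, fun k w w' h => ?_⟩, happ⟩
  · obtain rfl := (hf q).1 hq
    exact ⟨z, (hn z).2 rfl, y, hp⟩
  · exact ⟨y, (happ _ _).2 ⟨(hn k).1 hk, rfl⟩⟩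
  · exact ((happ _ _).1 h.1).2.trans ((happ _ _).1 h.2).2.symm

/-- The pair ⟨x, y⟩ = {{x}, {x, y}} has at most one element exactly when x = y. The identity is thus
the set of those members of A × A that have at most one element, a Δ₀ condition without parameters.
-/
theorem exists_identity (F : Facts M) (A : M) :
    ∃ I, Fun I A A ∧ ∀ x y, App I x y ↔ E x A ∧ y = x := by
  obtain ⟨P, hP⟩ := F.prod A A
  obtain ⟨I, hI⟩ := F.sepSubsingleton P
  have mem : ∀ p, E p I ↔ ∃ x, E x A ∧ Pair x x p := by
    intro p
    rw [hI, hP]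
    constructor
    · rintro ⟨⟨x, hx, y, hy, s, t, hs, ht, hp⟩, h⟩
      obtain rfl := h s ((hp s).2 (.inl rfl)) t ((hp t).2 (.inr rfl))
      obtain rfl : y = x := by simpa using (hs y).1 ((ht y).2 (.inr rfl))
      exact ⟨y, hx, s, s, hs, ht, hp⟩
    · rintro ⟨x, hx, s, t, hs, ht, hp⟩
      refine ⟨⟨x, hx, x, hx, s, t, hs, ht, hp⟩, fun a ha b hb => ?_⟩
      obtain rfl := hs.unique F ht
      rw [show a = s by simpa using (hp a).1 ha, show b = s by simpa using (hp b).1 hb]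
  have happ : ∀ x y, App I x y ↔ E x A ∧ y = x := by
    refine fun x y => ⟨?_, ?_⟩
    · rintro ⟨p, hp, hxy⟩
      obtain ⟨z, hz, hzz⟩ := (mem p).1 hp
      obtain ⟨rfl, rfl⟩ := hxy.inj hzz
      exact ⟨hz, rfl⟩
    · rintro ⟨hx, rfl⟩
      obtain ⟨p, hp⟩ := exists_pair F y y
      exact ⟨p, (mem p).2 ⟨y, hx, hp⟩, hp⟩
  refine ⟨I, ⟨fun p hp => ?_, fun x hx => ⟨x, hx, (happ _ _).2 ⟨hx, rfl⟩⟩, fun x y z h => ?_⟩, happ⟩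
  · obtain ⟨x, hx, hp⟩ := (mem p).1 hp
    exact ⟨x, hx, x, hx, hp⟩
  · exact ((happ _ _).1 h.1).2.trans ((happ _ _).1 h.2).2.symm

/-! ## The sentences `U(c_a)` -/

/-- A tuple given by a sequence of initial segments needs a last index in `m`, so with no variables
only the empty assignment is left. -/
theorem assign_empty_iff {m D h : M} (hm : Emp m) : Assign m D h ↔ Emp h := by
  constructor
  · rintro (h | ⟨s, ⟨-, ⟨k, hk, -⟩, -⟩, -⟩)
    · exact h.2
    · exact (hm k hk).elim
  · exact fun h => .inl ⟨hm, h⟩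

theorem Code₁.inj (F : Facts M) {c d : ℕ} {s t x : M} (h : Code₁ c s x) (h' : Code₁ d t x) :
    c = d ∧ s = t := by
  obtain ⟨o, ho, hx⟩ := h
  obtain ⟨o', ho', hx'⟩ := h'
  obtain ⟨rfl, rfl⟩ := hx.inj hx'
  exact ⟨ho.inj F ho', rfl⟩

/-- The two codes are pairs whose first coordinates are a numeral and a pair ⟨d, t⟩ respectively. A
nonzero numeral has ∅ as an element, whereas every element of a Kuratowski pair is nonempty. -/
theorem Code₁.not_code₂ (F : Facts M) {c d : ℕ} {s t w x : M} (h : Code₁ c s x) (hc : c ≠ 0) :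
    ¬ Code₂ d t w x := by
  rintro ⟨o', ho', q, hq, hx'⟩
  obtain ⟨o, ho, hx⟩ := h
  obtain ⟨rfl, rfl⟩ := hx.inj hx'
  obtain ⟨z, hz⟩ := F.empty
  exact hq.not_emp_mem ((numeral_mem_iff F ho z).2 ⟨0, by omega, hz⟩) hz

theorem value_const_iff {A I m h a c y : M} (hm : Emp m) (ha : E a A)
    (hc : Const a c) (hI : ∀ x y, App I x y ↔ E x A ∧ y = x) : Value A I m h c y ↔ y = a := by
  constructor
  · rintro (⟨i, hi, -⟩ | ⟨b, hb, ⟨o, ho, hbc⟩, hy⟩)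
    · exact (hm i hi).elim
    · obtain ⟨o', ho', hc⟩ := hc
      obtain ⟨-, rfl⟩ := hc.inj hbc
      exact ((hI _ _).1 hy).2
  · rintro rfl
    exact .inr ⟨y, ha, hc, (hI _ _).2 ⟨ha, rfl⟩⟩

/-- The atomic sentence U(c_a) is its own formation sequence of length 1, with the single entry at
index 0. -/
theorem exists_formation (F : Facts M) {A m a c x : M} (ha : E a A) (hc : Const a c)
    (hx : Code₁ 6 c x) :
    ∃ z n f, Emp z ∧ UPair z z n ∧ Suc z n ∧ (∀ k w, App f k w ↔ k = z ∧ w = x) ∧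
      Formation true false A m x f n := by
  obtain ⟨z, hz⟩ := F.empty
  obtain ⟨n, hn⟩ := exists_suc F z
  -- As `z` is empty, z ∪ {z} is the singleton {z}.
  have hn' : UPair z z n := fun w => (hn w).trans (by simpa using fun h => (hz w h).elim)
  obtain ⟨f, hf, happ⟩ := exists_singleton_fun F hn' x
  refine ⟨z, n, f, hz, hn', hn, happ, hz.natOrd.suc hn, hf,
    ⟨z, (hn z).2 (.inr rfl), hn, (happ _ _).2 ⟨rfl, rfl⟩⟩, fun k hk => ?_⟩
  obtain rfl : k = z := by simpa using (hn' k).1 hk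
  exact ⟨x, (happ _ _).2 ⟨rfl, rfl⟩, .inl (.inr (.inl ⟨rfl, c, .inr ⟨a, ha, hc⟩, hx⟩))⟩

/-- From left to right, the given witnesses may have any length, but their last entry is the code of
U(c_a), and comparing codes leaves only the clause for `U`. From right to left, sequences of length
1 suffice. -/
theorem sat_const_iff (F : Facts M) {A D U R I m a c x e : M} (hm : Emp m) (ha : E a A)
    (hc : Const a c) (hx : Code₁ 6 c x) (he : Emp e) (hI : ∀ x y, App I x y ↔ E x A ∧ y = x) :
    Sat true false A D U R I m x e ↔ E a U := by
  constructor
  · rintro ⟨f, g, n, ⟨hn, hf, ⟨k, hk, hkn, hfk⟩, -⟩, hg, hs, l, hl, hln, G, hG, heG⟩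
    -- The last index of the formation sequence and that of the sequence of satisfaction sets are
    -- both predecessors of `n`, hence equal.
    obtain rfl := hkn.inj_of_natOrd F hn hln
    obtain ⟨y, G', hy, hG', hs⟩ := hs k hk
    obtain rfl := hf.2.2 _ _ _ ⟨hfk, hy⟩
    obtain rfl := hg.2.2 _ _ _ ⟨hG, hG'⟩
    rcases hs with ⟨s, t, h, -⟩ | ⟨-, t, h, hs⟩ | ⟨h, -⟩ | ⟨j, -, z, H, -, -, h, -⟩ |
      ⟨j, -, l, -, z, w, H, K, -, -, -, -, h, -⟩ | ⟨j, -, i, -, z, H, -, -, h, -⟩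
    · exact (hx.not_code₂ F (by decide) h).elim
    · obtain ⟨-, rfl⟩ := hx.inj F h
      obtain ⟨y, hy, hv⟩ := ((hs e).1 heG).2
      rwa [← (value_const_iff hm ha hc hI).1 hv]
    · exact (Bool.false_ne_true h).elim
    · exact absurd (hx.inj F h).1 (by decide)
    · exact (hx.not_code₂ F (by decide) h).elim
    · exact (hx.not_code₂ F (by decide) h).elim
  · intro haU
    obtain ⟨z, n, f, hz, hn, hzn, hf, hform⟩ := exists_formation F (m := m) ha hc hx
    -- Here `n` doubles as the satisfaction set: it is 1 = {∅}, the set of all assignments to no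
    -- variables, and all of them satisfy U(c_a) since a ∈ U.
    obtain ⟨g, hg, happ⟩ := exists_singleton_fun F hn n
    have hzn' : E z n := (hn z).2 (.inl rfl)
    refine ⟨f, g, n, hform, hg, fun k hk => ?_, z, hzn', hzn, n, (happ _ _).2 ⟨rfl, rfl⟩, ?_⟩
    · obtain rfl : k = z := by simpa using (hn k).1 hk
      refine ⟨x, n, (hf _ _).2 ⟨rfl, rfl⟩, (happ _ _).2 ⟨rfl, rfl⟩,
        .inr (.inl ⟨rfl, c, hx, fun h => ?_⟩)⟩
      rw [assign_empty_iff hm, hn h, or_self]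
      constructor
      · rintro rfl
        exact ⟨hz, a, haU, (value_const_iff hm ha hc hI).2 rfl⟩
      · exact fun h => h.1.unique F hz
    · rwa [he.unique F hz]

/-! ## The powerset axiom -/

theorem structureWith_decode {A X I S D U R J : M} (hS : Triple A X I S)
    (h : StructureWith true false A D U R J S) : D = A ∧ U = X ∧ J = I :=
  h.1.2.inj hS

/-- Both structures have domain `A` and interpret each constant c_a as `a`, so agreement on the
sentences U(c_a) is agreement of the two subsets. -/
theorem ElemEmb.eq (F : Facts M) {A I X Y S T f : M} (hI : ∀ x y, App I x y ↔ E x A ∧ y = x)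
    (hX : Sub X A) (hY : Sub Y A) (hS : Triple A X I S) (hT : Triple A Y I T)
    (h : ElemEmb true false A S T f) : S = T := by
  obtain ⟨D, U, R, J, D', U', R', J', h₁, h₂, -, -, -, h⟩ := h
  obtain ⟨rfl, rfl, rfl⟩ := structureWith_decode hS h₁
  obtain ⟨rfl, rfl, rfl⟩ := structureWith_decode hT h₂
  obtain ⟨z, hz⟩ := F.empty
  have key : ∀ a, E a D' → (E a U ↔ E a U') := by
    intro a ha
    obtain ⟨o, ho⟩ := exists_numeral (M := M) F 1
    obtain ⟨c, hc⟩ := exists_pair F o a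
    obtain ⟨o', ho'⟩ := exists_numeral (M := M) F 6
    obtain ⟨x, hx⟩ := exists_pair F o' c
    have hc : Const a c := ⟨o, ho, hc⟩
    have hx : Code₁ 6 c x := ⟨o', ho', hx⟩
    obtain ⟨-, n, g, -, -, -, -, hg⟩ := exists_formation F (m := z) ha hc hx
    rw [← sat_const_iff F hz ha hc hx hz hI, ← sat_const_iff F hz ha hc hx hz hI]
    -- Elementarity is used with no variables: both assignments are empty, and their compatibility
    -- along `f` is vacuous.
    exact h z x z z ⟨hz.natOrd, ⟨g, n, hg⟩, .inl ⟨hz, hz⟩, .inl ⟨hz, hz⟩,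
      fun i hi => (hz i hi).elim⟩
  obtain rfl : U = U' := F.ext _ _ fun a =>
    ⟨fun ha => (key a (hX a ha)).1 ha, fun ha => (key a (hY a ha)).2 ha⟩
  exact hS.unique F hT

theorem exists_powerset (F : Facts M) (A : M) : ∃ b, ∀ x, E x b ↔ Sub x A := by
  obtain ⟨I, hIf, hI⟩ := exists_identity F A
  by_contra hpow
  have hvp := F.vp A I ?_ ?_
  · obtain ⟨S, T, ⟨X, hX, hS⟩, ⟨Y, hY, hT⟩, hST, f, hf⟩ := hvp
    exact hST (hf.eq F hI hX hY hS hT)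
  · rintro y ⟨X, hX, hy⟩
    obtain ⟨z, hz⟩ := F.empty
    -- The missing relation `R` is read as the empty set `z`.
    exact ⟨A, X, z, I, ⟨hz, hy⟩, hX, fun p hp => (hz p hp).elim, hIf⟩
  · intro x
    by_contra hx
    push Not at hx
    apply hpow
    -- With q = ⟨A, X⟩ and y = ⟨q, I⟩ there is a chain X ∈ {A, X} ∈ q ∈ {q} ∈ y ∈ x, so four unions
    -- of `x` reach every subset `X` of `A`.
    obtain ⟨u₁, h₁⟩ := F.union x
    obtain ⟨u₂, h₂⟩ := F.union u₁
    obtain ⟨u₃, h₃⟩ := F.union u₂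
    obtain ⟨u₄, h₄⟩ := F.union u₃
    obtain ⟨b, hb⟩ := F.sepSub A u₄
    refine ⟨b, fun X => (hb X).trans ⟨And.right, fun hX => ⟨?_, hX⟩⟩⟩
    obtain ⟨q, hq⟩ := exists_pair F A X
    obtain ⟨y, hy⟩ := exists_pair F q I
    have hyx := (hx y).1 ⟨X, hX, q, hq, hy⟩
    obtain ⟨s, t, hs, -, hy⟩ := hy
    obtain ⟨s', t', -, ht', hq⟩ := hq
    exact (h₄ X).2 ⟨t', (h₃ t').2 ⟨q, (h₂ q).2 ⟨s, (h₁ s).2 ⟨y, hyx, (hy s).2 (.inl rfl)⟩,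
      (hs q).2 (.inl rfl)⟩, (hq t').2 (.inr rfl)⟩, (ht' X).2 (.inr rfl)⟩

end SetTheory

/-! ### From models to first-order consequence -/

theorem models_axPow : EST ∪ VP ⊨ᵇ axPow := by
  rw [Theory.models_sentence_iff]
  intro N
  unfold axPow
  rw [realize_close]
  intro xs
  simpa (disch := omega) only [realize_all, realize_ex, realize_equiv, realize_mem, realize_subset,
    Function.update_self, Function.update_of_ne] using exists_powerset (facts_of_model N.is_model)

end VopenkaEST

theorem mainTheorem3 :
    (VopenkaEST.EST ∪ VopenkaEST.VP ∪ VopenkaEST.Delta0Rep ⊨ᵇ VopenkaEST.axPow) ∧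
    (VopenkaEST.EST ∪ VopenkaEST.VP ⊨ᵇ VopenkaEST.axPow) := by
  refine ⟨?_, VopenkaEST.models_axPow⟩
  rw [FirstOrder.Language.Theory.models_sentence_iff]
  intro N
  -- Consequence is monotone: a model of the larger theory is a model of EST + VP.
  have : N ⊨ VopenkaEST.EST ∪ VopenkaEST.VP :=
    N.is_model.mono Set.subset_union_left
  exact VopenkaEST.models_axPow.realize_sentence N
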